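/- Let $X$ be a connected compactly generated space, i.e. a connected Hausdorff space in which every set whose intersection with each compact set is closed is itself closed. Let $C(X)$ be the space of all continuous functions $X\to\mathbb{C}$ with the compact-open topology. A normed space of continuous functions (NSCF) over $X$ is a linear subspace $F\subset C(X)$ with a norm for which the inclusion $F\to C(X)$ is continuous; $B_F$ and $\overline{B}_F$ denote its open and closed unit balls. Call $F$ *1-independent* if for every $x\in X$ there is $f\in F$ with $f(x)\neq 0$; *(weakly) compactly embedded* if $B_F$ is (weakly) relatively compact in $C(X)$. Call a normed space *nearly strictly convex* if every convex subset of its unit sphere is totally bounded. **Theorem.** Let $F$ be a 1-independent NSCF over $X$, and suppose that at least one of the following conditions holds: (i) $F$ is compactly embedded; (ii) $F$ is weakly compactly embedded and nearly strictly convex, and $\overline{B}_F$ is closed in $C(X)$; (iii) $F$ is weakly compactly embedded and the bidual $F^{**}$ is nearly strictly convex; (iv) $F$ is reflexive and nearly strictly convex. Let $\omega:X\to\mathbb{C}$ be any function (not assumed continuous) such that the multiplication operator $M_\omega f=\omega f$ maps $F$ into $F$ and is a surjective isometry of $F$. Then there is $\lambda\in\mathbb{C}$ with $|\lambda|=1$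 such that $\omega(x)=\lambda$ for all $x\in X$. -/

import Mathlib

/-- A linear subspace of the space `C(X, ℂ)` of continuous complex-valued functions on `X`,
equipped with a norm (a seminorm vanishing only at the zero function). -/
structure NormedFunctionSubspace (X : Type*) [TopologicalSpace X] where
  /-- the underlying linear subspace -/
  carrier : Submodule ℂ C(X, ℂ)
  /-- the norm on the subspace -/
  normFun : Seminorm ℂ carrier
  eq_zero_of_normFun_eq_zero : ∀ f : carrier, normFun f = 0 → f = 0

namespace NormedFunctionSubspace

variable {X : Type*} [TopologicalSpace X]

/-- The subspace as a type of its own. It carries the given norm and the norm topology, and not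
the subspace topology inherited from `C(X, ℂ)`. -/
def Space (F : NormedFunctionSubspace X) : Type _ := F.carrier

noncomputable instance (F : NormedFunctionSubspace X) : AddCommGroup F.Space :=
  inferInstanceAs (AddCommGroup F.carrier)

noncomputable instance (F : NormedFunctionSubspace X) : Module ℂ F.Space :=
  inferInstanceAs (Module ℂ F.carrier)

/-- The given norm, in the form from which the normed group structure is built. -/
noncomputable def addGroupNorm (F : NormedFunctionSubspace X) : AddGroupNorm F.Space where
  toFun f := F.normFun f
  map_zero' := map_zero F.normFun
  add_le' f g := map_add_le_add F.normFun f g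
  neg' f := map_neg_eq_map F.normFun f
  eq_zero_of_map_eq_zero' f hf := F.eq_zero_of_normFun_eq_zero f hf

noncomputable instance (F : NormedFunctionSubspace X) : NormedAddCommGroup F.Space :=
  F.addGroupNorm.toNormedAddCommGroup

theorem norm_def (F : NormedFunctionSubspace X) (f : F.Space) : ‖f‖ = F.normFun f := rfl

noncomputable instance (F : NormedFunctionSubspace X) : NormedSpace ℂ F.Space where
  norm_smul_le c f := le_of_eq (map_smul_eq_mul F.normFun c f)

/-- The inclusion of the subspace into `C(X, ℂ)`. -/
noncomputable def incl (F : NormedFunctionSubspace X) : F.Space →ₗ[ℂ] C(X, ℂ) := F.carrier.subtype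

end NormedFunctionSubspace

/-- A normed space of continuous functions over `X`: a linear subspace of `C(X, ℂ)` with a norm
whose topology is stronger than the compact-open topology (the topology that `C(X, ℂ)` has as an
instance), i.e. the inclusion into `C(X, ℂ)` is continuous. -/
structure NSCF (X : Type*) [TopologicalSpace X] extends NormedFunctionSubspace X where
  continuous_incl : Continuous toNormedFunctionSubspace.incl

/-- A complex normed space is nearly strictly convex if every convex subset of its unit sphere is
precompact (totally bounded). -/
def NearlyStrictlyConvex (E : Type*) [NormedAddCommGroup E] [NormedSpace ℂ E] : Prop :=
  ∀ D : Set E, D ⊆ Metric.sphere (0 : E) 1 → Convex ℝ D → TotallyBounded D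

/-- A complex normed space is reflexive if the canonical embedding into its bidual is onto. -/
def IsReflexiveNormedSpace (E : Type*) [NormedAddCommGroup E] [NormedSpace ℂ E] : Prop :=
  Function.Surjective (NormedSpace.inclusionInDoubleDual ℂ E)

namespace NSCF

variable {X : Type*} [TopologicalSpace X]

/-- The inclusion operator, as a continuous linear map from the normed space into `C(X, ℂ)` with
the compact-open topology. -/
noncomputable def inclusion (F : NSCF X) : F.Space →L[ℂ] C(X, ℂ) where
  toLinearMap := F.incl
  cont := F.continuous_incl

/-- `F` is `1`-independent: no point evaluation vanishes identically on `F`. -/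
def OneIndependent (F : NSCF X) : Prop :=
  ∀ x : X, ∃ f : F.Space, F.inclusion f x ≠ 0

/-- `F` is compactly embedded: the inclusion operator is compact. -/
def CompactlyEmbedded (F : NSCF X) : Prop :=
  IsCompactOperator F.inclusion

/-- `F` is weakly compactly embedded: its unit ball is relatively compact for the weak topology
of the locally convex space `C(X, ℂ)`. -/
def WeaklyCompactlyEmbedded (F : NSCF X) : Prop :=
  IsCompact (closure
    ((fun f : F.Space => toWeakSpace ℂ C(X, ℂ) (F.inclusion f)) '' Metric.ball 0 1))

/-- The closed unit ball of `F` is closed in `C(X, ℂ)`. -/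
def ClosedUnitBallIsClosed (F : NSCF X) : Prop :=
  IsClosed (F.inclusion '' Metric.closedBall 0 1)

/-- `ω : X → ℂ` (an arbitrary function) is such that the multiplication operator `f ↦ ω f` maps
`F` into itself and is a unitary, i.e. a surjective linear isometry, of `F`. -/
def IsUnitaryMultiplier (F : NSCF X) (ω : X → ℂ) : Prop :=
  ∃ T : F.Space ≃ₗᵢ[ℂ] F.Space, ∀ (f : F.Space) (x : X),
    F.inclusion (T f) x = ω x * F.inclusion f x

end NSCF

/-!
A unitary multiplier `ω` is unimodular, because multiplication by `ω` scales the functional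
`f ↦ f x` by `ω x` and preserves its norm. The heart of the proof is a mean ergodic argument: for
`‖c‖ = 1` and `f ∈ F`, the averages `N⁻¹ ∑_{n < N} c⁻ⁿ ωⁿ f` stay in the ball of radius `‖f‖`
of `F`, and they converge pointwise to the function equal to `f` on `{ω = c}` and to `0` elsewhere
(`tendsto_geom_average`). Under each of the four hypotheses the unit ball of `F` lies in a compact
set for some topology that makes the point evaluations continuous, so a pointwise limit of a
sequence from the ball coincides with a cluster point that is a continuous function
(`NSCF.continuous_of_tendsto_of_norm_lt_one`). Hence `f` cut off to `{ω = c}` is continuous;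
choosing `f` with `f x ≠ 0` and `c = ω x` shows that `ω` is constant near `x`. A locally constant
function on a connected space is constant.
-/

open Filter Topology

/-- The scalar mean ergodic theorem on the closed unit disc. -/
theorem tendsto_geom_average {z : ℂ} (hz : ‖z‖ ≤ 1) :
    Tendsto (fun N : ℕ => (N : ℂ)⁻¹ * ∑ n ∈ Finset.range N, z ^ n) atTop
      (𝓝 (if z = 1 then 1 else 0)) := by
  split_ifs with h
  · subst h
    refine tendsto_const_nhds.congr' ?_
    filter_upwards [eventually_ne_atTop 0] with N hN
    simp [hN]
  · refine squeeze_zero_norm (a := fun N : ℕ => (N : ℝ)⁻¹ * (2 / ‖z - 1‖)) (fun N => ?_) ?_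
    · rw [geom_sum_eq h, norm_mul, norm_inv, Complex.norm_natCast, norm_div]
      gcongr
      calc ‖z ^ N - 1‖ ≤ ‖z‖ ^ N + 1 := by simpa using norm_sub_le (z ^ N) 1
        _ ≤ 2 := by linarith [pow_le_one₀ (norm_nonneg z) hz (n := N)]
    · simpa using
        (tendsto_inv_atTop_nhds_zero_nat (𝕜 := ℝ)).mul_const (2 / ‖z - 1‖)

/-- If continuous functions `e y` are parametrized so that each `y ↦ e y x` is continuous, then
the pointwise limit of a sequence of such functions with parameters in a compact set is again one
of the `e y`, hence continuous. -/
theorem IsCompact.continuous_of_tendsto_pointwise {X Y : Type*} [TopologicalSpace X]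
    [TopologicalSpace Y] {S : Set Y} (hS : IsCompact S) {e : Y → C(X, ℂ)}
    (he : ∀ x, Continuous fun y => e y x) {u : ℕ → Y} (hu : ∀ n, u n ∈ S) {φ : X → ℂ}
    (hφ : ∀ x, Tendsto (fun n => e (u n) x) atTop (𝓝 (φ x))) : Continuous φ := by
  obtain ⟨y, -, hy⟩ := hS.exists_mapClusterPt (f := atTop) (u := u)
    (tendsto_principal.2 (Eventually.of_forall hu))
  have h : φ = e y := by
    funext x
    have hc : MapClusterPt (e y x) atTop fun n => e (u n) x :=
      hy.tendsto_comp (he x).continuousAt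
    exact (eq_of_nhds_neBot (hc.clusterPt.neBot.mono (inf_le_inf_left _ (hφ x)))).symm
  exact h ▸ (e y).continuous

namespace NSCF

variable {X : Type*} [TopologicalSpace X]

/-- Evaluation at a point, as a bounded functional on `F`. -/
noncomputable def pointEval (F : NSCF X) (x : X) : StrongDual ℂ F.Space :=
  (ContinuousMap.evalCLM ℂ x).comp F.inclusion

@[simp]
theorem pointEval_apply (F : NSCF X) (x : X) (f : F.Space) :
    F.pointEval x f = F.inclusion f x := rfl

/-- In the reflexive case the compact set is the unit ball of the bidual with the weak-star
topology. -/
theorem continuous_of_tendsto_of_norm_lt_one (F : NSCF X)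
    (h : F.CompactlyEmbedded ∨ F.WeaklyCompactlyEmbedded ∨ IsReflexiveNormedSpace F.Space)
    {u : ℕ → F.Space} (hu : ∀ n, ‖u n‖ < 1) {φ : X → ℂ}
    (hφ : ∀ x, Tendsto (fun n => F.inclusion (u n) x) atTop (𝓝 (φ x))) : Continuous φ := by
  have hball : ∀ n, u n ∈ Metric.ball (0 : F.Space) 1 := fun n => by simpa using hu n
  rcases h with h | h | h
  · obtain ⟨K, hK, hsub⟩ := IsCompactOperator.image_ball_subset_compact
      (f := F.inclusion.toLinearMap) h 1
    exact hK.continuous_of_tendsto_pointwise (e := id) (u := fun n => F.inclusion (u n))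
      (fun x => continuous_eval_const x)
      (fun n => hsub ⟨u n, hball n, rfl⟩) hφ
  · exact IsCompact.continuous_of_tendsto_pointwise h (e := (toWeakSpace ℂ C(X, ℂ)).symm)
      (u := fun n => toWeakSpace ℂ C(X, ℂ) (F.inclusion (u n)))
      (fun x => WeakBilin.eval_continuous (topDualPairing ℂ C(X, ℂ)).flip
        (ContinuousMap.evalCLM ℂ x))
      (fun n => subset_closure ⟨u n, hball n, rfl⟩) hφ
  · have hinv (y : WeakDual ℂ (StrongDual ℂ F.Space)) (x : X) :
        F.inclusion (Function.surjInv h (WeakDual.toStrongDual y)) x = y (F.pointEval x) :=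
      congrArg (fun z : StrongDual ℂ (StrongDual ℂ F.Space) => z (F.pointEval x))
        (Function.surjInv_eq h (WeakDual.toStrongDual y))
    refine (WeakDual.isCompact_closedBall (0 : StrongDual ℂ (StrongDual ℂ F.Space))
      1).continuous_of_tendsto_pointwise
      (e := fun y => F.inclusion (Function.surjInv h (WeakDual.toStrongDual y)))
      (u := fun n => StrongDual.toWeakDual (NormedSpace.inclusionInDoubleDual ℂ F.Space (u n)))
      (fun x => ?_) (fun n => ?_) (fun x => ?_)
    · simp only [hinv]
      exact WeakDual.eval_continuous _
    · simpa using (NormedSpace.double_dual_bound ℂ F.Space (u n)).trans (hu n).le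
    · simp only [hinv]
      exact hφ x

theorem inclusion_pow_apply (F : NSCF X) {ω : X → ℂ} {T : F.Space ≃ₗᵢ[ℂ] F.Space}
    (hT : ∀ (f : F.Space) (x : X), F.inclusion (T f) x = ω x * F.inclusion f x) (n : ℕ)
    (f : F.Space) (x : X) : F.inclusion ((T ^ n) f) x = ω x ^ n * F.inclusion f x := by
  induction n with
  | zero => simp
  | succ n ih =>
    rw [pow_succ' T, show (T * T ^ n) f = T ((T ^ n) f) from rfl, hT, ih]
    ring

theorem IsUnitaryMultiplier.norm_apply {F : NSCF X} {ω : X → ℂ} (hω : F.IsUnitaryMultiplier ω)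
    (hF : F.OneIndependent) (x : X) : ‖ω x‖ = 1 := by
  obtain ⟨T, hT⟩ := hω
  obtain ⟨f, hf⟩ := hF x
  have hne : F.pointEval x ≠ 0 := fun h => hf (by simpa using DFunLike.congr_fun h f)
  have hcomp : (F.pointEval x).comp (T : F.Space →L[ℂ] F.Space) = ω x • F.pointEval x :=
    ContinuousLinearMap.ext fun g => hT g x
  have hnorm := (F.pointEval x).opNorm_comp_linearIsometryEquiv T
  rw [hcomp, norm_smul] at hnorm
  exact mul_right_cancel₀ (norm_ne_zero_iff.2 hne) (hnorm.trans (one_mul _).symm)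

open Classical in
/-- The limit of the ergodic averages of `f` under `c⁻¹ ω`, which is `f` cut off to a level set
of `ω`, is continuous. -/
theorem IsUnitaryMultiplier.continuous_indicator_fiber {F : NSCF X} {ω : X → ℂ}
    (hω : F.IsUnitaryMultiplier ω) (hF : F.OneIndependent)
    (h : F.CompactlyEmbedded ∨ F.WeaklyCompactlyEmbedded ∨ IsReflexiveNormedSpace F.Space)
    {c : ℂ} (hc : ‖c‖ = 1) {f : F.Space} (hf : ‖f‖ < 1) :
    Continuous fun x => if ω x = c then F.inclusion f x else 0 := by
  have hnorm := hω.norm_apply hF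
  obtain ⟨T, hT⟩ := hω
  have hc0 : c ≠ 0 := norm_ne_zero_iff.1 (by simp [hc])
  refine F.continuous_of_tendsto_of_norm_lt_one h
    (u := fun N : ℕ => (N : ℂ)⁻¹ • ∑ n ∈ Finset.range N, c⁻¹ ^ n • (T ^ n) f)
    (fun N => lt_of_le_of_lt ?_ hf) (fun x => ?_)
  · have hsum : ‖∑ n ∈ Finset.range N, c⁻¹ ^ n • (T ^ n) f‖ ≤ N * ‖f‖ := by
      refine (norm_sum_le _ _).trans (le_of_eq ?_)
      simp [norm_smul, hc]
    rw [norm_smul, norm_inv, Complex.norm_natCast]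
    rcases Nat.eq_zero_or_pos N with rfl | hN
    · simp
    · rwa [inv_mul_le_iff₀ (by exact_mod_cast hN)]
  · have hz : ‖c⁻¹ * ω x‖ ≤ 1 := by simp [hc, hnorm x]
    have hlim := (tendsto_geom_average hz).mul_const (F.inclusion f x)
    have hiff : c⁻¹ * ω x = 1 ↔ ω x = c := by
      rw [inv_mul_eq_one₀ hc0, eq_comm]
    simp only [hiff, ite_mul, one_mul, zero_mul] at hlim
    refine hlim.congr fun N => Eq.symm ?_
    have hpow (n : ℕ) : F.pointEval x ((T ^ n) f) = ω x ^ n * F.inclusion f x :=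
      F.inclusion_pow_apply hT n f x
    refine (F.pointEval_apply x _).symm.trans ?_
    rw [map_smul, map_sum]
    simp only [map_smul, hpow, smul_eq_mul, mul_assoc, Finset.sum_mul, mul_pow]

theorem IsUnitaryMultiplier.isLocallyConstant {F : NSCF X} {ω : X → ℂ}
    (hω : F.IsUnitaryMultiplier ω) (hF : F.OneIndependent)
    (h : F.CompactlyEmbedded ∨ F.WeaklyCompactlyEmbedded ∨ IsReflexiveNormedSpace F.Space) :
    IsLocallyConstant ω := by
  classical
  refine (IsLocallyConstant.iff_eventually_eq ω).2 fun x => ?_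
  obtain ⟨g, hg⟩ := hF x
  -- Rescale `g` into the open unit ball.
  obtain ⟨r, hr0, hr⟩ : ∃ r : ℂ, r ≠ 0 ∧ ‖r • g‖ < 1 := by
    have hpos : (0 : ℝ) < ‖g‖ + 1 := by positivity
    refine ⟨((‖g‖ + 1 : ℝ) : ℂ)⁻¹, inv_ne_zero (by exact_mod_cast hpos.ne'), ?_⟩
    rw [norm_smul, norm_inv, Complex.norm_real, Real.norm_of_nonneg hpos.le,
      inv_mul_lt_iff₀ hpos]
    linarith
  have hcont := hω.continuous_indicator_fiber hF h (hω.norm_apply hF x) hr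
  have hx : (if ω x = ω x then F.inclusion (r • g) x else 0) ≠ 0 := by
    simpa using ⟨hr0, hg⟩
  filter_upwards [hcont.continuousAt.eventually_ne hx] with y hy
  by_contra hne
  exact hy (if_neg hne)

end NSCF

theorem mainTheorem1 {X : Type*} [TopologicalSpace X] [T2Space X] [CompactlyCoherentSpace X]
    [PreconnectedSpace X] (F : NSCF X) (hF : F.OneIndependent)
    (hcases :
      F.CompactlyEmbedded ∨
      (F.WeaklyCompactlyEmbedded ∧ NearlyStrictlyConvex F.Space ∧ F.ClosedUnitBallIsClosed) ∨
      (F.WeaklyCompactlyEmbedded ∧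
        NearlyStrictlyConvex (StrongDual ℂ (StrongDual ℂ F.Space))) ∨
      (IsReflexiveNormedSpace F.Space ∧ NearlyStrictlyConvex F.Space))
    (ω : X → ℂ) (hω : F.IsUnitaryMultiplier ω) :
    ∃ c : ℂ, ‖c‖ = 1 ∧ ∀ x : X, ω x = c := by
  have h : F.CompactlyEmbedded ∨ F.WeaklyCompactlyEmbedded ∨
      IsReflexiveNormedSpace F.Space := by
    tauto
  rcases isEmpty_or_nonempty X with hX | ⟨⟨x₀⟩⟩
  · exact ⟨1, norm_one, fun x => isEmptyElim x⟩
  · exact ⟨ω x₀, hω.norm_apply hF x₀, fun x =>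
      (hω.isLocallyConstant hF h).apply_eq_of_preconnectedSpace x x₀⟩
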